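/- Let $p\ge 1$ be a real number, let $X$ be a complex Banach space, $T\in B(X)$, and let $(c_j)_{j\ge 1}$ be a sequence of positive numbers which is submultiplicative, i.e. $c_{i+j}\le c_ic_j$ for all $i,j\ge 1$. For $R\in B(X)$ put $m(R)=\inf\{\|Rx\| : x\in X,\ \|x\|=1\}$. Assume that $(c_j)$ satisfies condition $(*)_p$ for $T$: there is a strictly increasing sequence of integers $0=k_0<k_1<k_2<\cdots$ such that $$c_j\ \ge\ \frac{2^{(n+1)(p-1)/p}\,(k_{n+1}-k_n)^{(p-1)/p}}{m(T^{k_1})\,m(T^{k_2-k_1})\cdots m(T^{k_{n+1}-k_n})}\ \|T^{k_{n+1}-j}\|$$ for all $n\ge 0$ and all $j$ with $k_n<j\le k_{n+1}$ (in particular, if $X\ne 0$, the denominators are nonzero). Then there exist a complex Banach space $Y$ which is an $SQ_p(X)$-space, that is, isometrically isomorphic to a quotient of a closed subspace of a Banach space ultraproduct of spaces of the form $L_p(\Omega,\mu,X)$ for some measure spaces $(\Omega,\mu)$, a bounded linear map $\pi:X\to Y$ with $$\frac{\|x\|}{2^{(p-1)/p}}\le\|\pi(x)\|\le\|x\|\qquad(x\in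 X),$$ and an invertible operator $S\in B(Y)$ such that $S\pi=\pi T$, $\|S^{-j}\|\le c_j$ and $\|S^j\|\le\|T^j\|$ for all $j\ge 1$, and $\sigma(S)\subset\sigma(T)$. Moreover, $S^{-1}$ is $(c,p)$-near the null operator modulo $\pi(X)$, that is, $$\Bigl\|\sum_{j=1}^{n}S^{-j}\pi(y_j)\Bigr\|\le\Bigl(\sum_{j=1}^{n}c_j^p\,\|y_j\|^p\Bigr)^{1/p}$$ for every $n\ge 1$ and all $y_1,\dots,y_n\in X$. -/

import Mathlib

open Filter Topology MeasureTheory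
open scoped ENNReal

universe u

noncomputable section

/-- The minimum modulus `m(T) = inf {‖T x‖ : ‖x‖ = 1}` of a bounded operator. -/
def minModulus {X : Type*} [NormedAddCommGroup X] [NormedSpace ℂ X] (T : X →L[ℂ] X) : ℝ :=
  ⨅ x : Metric.sphere (0 : X) 1, ‖T (x : X)‖

/-- Condition `(*)_p` for the sequence `(c_j)_{j ≥ 1}` (the value `c 0` is never used) and the
operator `T`. The denominator `m(T^{k_1}) m(T^{k_2 - k_1}) ⋯ m(T^{k_{n+1} - k_n})` is multiplied
out, so that no division by zero can occur: if `X ≠ 0` and the product vanishes, then the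
inequality for `j = k_{n+1}` fails, as it should. -/
def SatisfiesStar {X : Type*} [NormedAddCommGroup X] [NormedSpace ℂ X]
    (p : ℝ) (c : ℕ → ℝ) (T : X →L[ℂ] X) : Prop :=
  ∃ k : ℕ → ℕ, StrictMono k ∧ k 0 = 0 ∧
    ∀ n j : ℕ, k n < j → j ≤ k (n + 1) →
      (2 : ℝ) ^ (((n : ℝ) + 1) * (p - 1) / p) * ((k (n + 1) : ℝ) - (k n : ℝ)) ^ ((p - 1) / p)
          * ‖T ^ (k (n + 1) - j)‖
        ≤ c j * ∏ i ∈ Finset.range (n + 1), minModulus (T ^ (k (i + 1) - k i))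

/-- The operators `A` and `C` on `Y` are `(β, p)`-near modulo the image of `π : X → Y`; on the
right-hand side the vectors are measured in the norm of `X`. -/
def IsNearModulo {X Y : Type*} [NormedAddCommGroup X] [NormedSpace ℂ X]
    [NormedAddCommGroup Y] [NormedSpace ℂ Y]
    (β : ℕ → ℝ) (p : ℝ) (π : X →L[ℂ] Y) (A C : Y →L[ℂ] Y) : Prop :=
  ∀ (N : ℕ) (x : ℕ → X),
    ‖∑ n ∈ Finset.Icc 1 N, (A ^ n - C ^ n) (π (x n))‖
      ≤ (∑ n ∈ Finset.Icc 1 N, β n ^ p * ‖x n‖ ^ p) ^ (1 / p)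

/-- The bounded families that tend to `0` in norm along the ultrafilter `U`. -/
def ultraNull {I : Type*} (U : Ultrafilter I) (E : I → Type*) [∀ i, NormedAddCommGroup (E i)]
    [∀ i, NormedSpace ℂ (E i)] : Submodule ℂ (lp E ∞) where
  carrier := {x | Tendsto (fun i => ‖x i‖) (U : Filter I) (𝓝 0)}
  zero_mem' := by simp
  add_mem' := by
    intro x y hx hy
    have h : Tendsto (fun i => ‖x i‖ + ‖y i‖) (U : Filter I) (𝓝 0) := by
      simpa using Tendsto.add hx hy
    exact squeeze_zero (fun i => norm_nonneg _) (fun i => norm_add_le (x i) (y i)) h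
  smul_mem' := by
    intro a x hx
    have h : Tendsto (fun i => ‖a‖ * ‖x i‖) (U : Filter I) (𝓝 0) := by
      simpa using Tendsto.const_mul ‖a‖ hx
    exact squeeze_zero (fun i => norm_nonneg _) (fun i => (norm_smul a (x i)).le) h

/-- The Banach space ultraproduct of the family `E` along `U`: the space `ℓ_∞(I, E)` of bounded
families modulo the families that tend to `0` along `U`, with the quotient norm. -/
abbrev BanachUltraproduct {I : Type*} (U : Ultrafilter I) (E : I → Type*)
    [∀ i, NormedAddCommGroup (E i)] [∀ i, NormedSpace ℂ (E i)] : Type _ :=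
  lp E ∞ ⧸ ultraNull U E

/-- `E` is isometrically isomorphic to a quotient (by a closed subspace) of a closed subspace
of `Z`. -/
def IsQuotientOfSubspace (E Z : Type*) [SeminormedAddCommGroup E] [NormedSpace ℂ E]
    [SeminormedAddCommGroup Z] [NormedSpace ℂ Z] : Prop :=
  ∃ F : Submodule ℂ Z, IsClosed (F : Set Z) ∧
    ∃ K : Submodule ℂ F, IsClosed (K : Set F) ∧ Nonempty (E ≃ₗᵢ[ℂ] (F ⧸ K))

theorem fact_one_le_ofReal {p : ℝ} (hp : 1 ≤ p) : Fact (1 ≤ ENNReal.ofReal p) :=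
  ⟨ENNReal.one_le_ofReal.2 hp⟩

/-- `E` is an `SQ_p(X)`-space: a quotient of a subspace of an ultraproduct of spaces
`L_p(Ω_i, μ_i, X)` over arbitrary measure spaces `(Ω_i, μ_i)`. -/
def IsSQpSpace (p : ℝ) (hp : 1 ≤ p) (X E : Type u)
    [NormedAddCommGroup X] [NormedSpace ℂ X] [NormedAddCommGroup E] [NormedSpace ℂ E] : Prop :=
  haveI : Fact (1 ≤ ENNReal.ofReal p) := fact_one_le_ofReal hp
  ∃ (I : Type u) (U : Ultrafilter I) (Ω : I → Type u) (_ : ∀ i, MeasurableSpace (Ω i))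
    (μ : ∀ i, Measure (Ω i)),
    IsQuotientOfSubspace E
      (BanachUltraproduct U (fun i => Lp X (ENNReal.ofReal p) (μ i)))

end

/-!
The space `Y` is an explicit quotient of `ℓ_p(ℕ, X)`, which is `L_p(X)` for the counting measure;
so it is an `SQ_p(X)`-space for an obvious reason, without a characterisation of such spaces.

Put `w 0 = 1` and `w j = c j` for `j ≥ 1`. The sequence `(w j • x j)` of `ℓ_p(ℕ, X)` stands for the
formal sum `∑ S⁻ʲ π (x j)`, and `Y` is the quotient by the closed span of the relations
`S⁻ʲ x = S⁻ʲ⁻¹ T x` (`orbitRelations`). On `ℓ_p(ℕ, X)`, `S⁻¹` is a weighted right shift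
(`weightedShift`), whose `j`-th power has norm at most `c j` by submultiplicativity, and `S` is the
coordinatewise action of `T` (`lpDiag`). Both respect the relations, and modulo the relations they
are inverse to each other. An operator that commutes with `T` acts on `Y` in the same way; applied to
the resolvent of `T` this gives the inclusion of the spectra. The estimate that makes `S⁻¹` near the
null operator is the norm of a finitely supported sequence.

The point that needs the condition on `c` is the lower estimate for `π` (`norm_le_norm_single_sub`).
A relation between `x` and `x 0, …, x n` says that `T ^ n (x - x 0) = ∑ T ^ (n - j) (x j)`,
`0 < j ≤ n`. For `n = k N` this identity is solved backwards along the blocks `(k i, k (i + 1)]`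
(`norm_le_of_pow_eq_sum`): one block costs a division by the minimum modulus of
`T ^ (k (i + 1) - k i)`, and Hölder's inequality within the blocks and over them, with the geometric
weights `2⁻¹, 2⁻², …`, gives `‖x - x 0‖ ≤ (∑ c j ^ p ‖x j‖ ^ p) ^ (1 / p)`. The constant
`2 ^ ((p - 1) / p)` comes from adding `‖x 0‖`.
-/

/-! ### Quotients and `SQ_p(X)`-spaces -/

/-- A linear isometric equivalence descends to the quotients by corresponding submodules. -/
noncomputable def LinearIsometryEquiv.quotientMap {Z W : Type*} [SeminormedAddCommGroup Z]
    [NormedSpace ℂ Z] [SeminormedAddCommGroup W] [NormedSpace ℂ W] (e : Z ≃ₗᵢ[ℂ] W)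
    (N : Submodule ℂ Z) : (Z ⧸ N) ≃ₗᵢ[ℂ] W ⧸ N.map (e.toLinearEquiv : Z →ₗ[ℂ] W) where
  toLinearEquiv := Submodule.Quotient.equiv N _ e.toLinearEquiv rfl
  norm_map' y := by
    apply le_antisymm
    · refine le_of_forall_pos_le_add fun ε hε => ?_
      obtain ⟨z, rfl, hz⟩ := Submodule.Quotient.norm_mk_lt y hε
      refine le_trans ?_ hz.le
      refine (Submodule.Quotient.norm_mk_le _ (e z)).trans ?_
      simp
    · refine le_of_forall_pos_le_add fun ε hε => ?_
      obtain ⟨w, hw, hw'⟩ := Submodule.Quotient.norm_mk_lt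
        (Submodule.Quotient.equiv N _ e.toLinearEquiv rfl y) hε
      have : y = Submodule.Quotient.mk (e.symm w) := by
        apply (Submodule.Quotient.equiv N _ e.toLinearEquiv rfl).injective
        rw [← hw]
        simp
      refine le_trans ?_ hw'.le
      rw [this]
      refine (Submodule.Quotient.norm_mk_le _ (e.symm w)).trans ?_
      simp

/-- A quotient of `Z` is in particular a quotient of a subspace of any isometric copy of `Z`: the
subspace is the whole space. -/
theorem isQuotientOfSubspace_of_linearIsometryEquiv {Z W : Type*} [SeminormedAddCommGroup Z]
    [NormedSpace ℂ Z] [SeminormedAddCommGroup W] [NormedSpace ℂ W] (e : Z ≃ₗᵢ[ℂ] W)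
    (N : Submodule ℂ Z) (hN : IsClosed (N : Set Z)) : IsQuotientOfSubspace (Z ⧸ N) W := by
  let e' : Z ≃ₗᵢ[ℂ] (⊤ : Submodule ℂ W) := e.trans (LinearIsometryEquiv.ofTop W ⊤ rfl).symm
  refine ⟨⊤, isClosed_univ, N.map (e'.toLinearEquiv : Z →ₗ[ℂ] (⊤ : Submodule ℂ W)), ?_,
    ⟨e'.quotientMap N⟩⟩
  have := e'.toHomeomorph.isClosedMap _ hN
  convert this using 1
  · rfl
  · ext; simp [e']; rfl

/-- The one-term family with value `x`. -/
def lpPUnitConst {E : Type u} [NormedAddCommGroup E] (x : E) : lp (fun _ : PUnit.{u + 1} => E) ∞ :=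
  ⟨fun _ => x, show Memℓp (E := fun _ : PUnit.{u + 1} => E) (fun _ => x) ∞ from Memℓp.all _⟩

/-- An ultraproduct over a one-point index set is the space itself. -/
noncomputable def ultraproductPUnit (E : Type u) [NormedAddCommGroup E] [NormedSpace ℂ E] :
    E ≃ₗᵢ[ℂ] BanachUltraproduct (pure PUnit.unit : Ultrafilter PUnit.{u + 1}) (fun _ => E) :=
  LinearIsometryEquiv.ofSurjective
    { toFun x := Submodule.Quotient.mk (lpPUnitConst x)
      map_add' _ _ := rfl
      map_smul' _ _ := rfl
      norm_map' x := by
        have hx : ‖lpPUnitConst x‖ = ‖x‖ := by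
          rw [lp.norm_eq_ciSup]
          exact ciSup_const (ι := PUnit.{u + 1}) (a := ‖x‖)
        apply le_antisymm
        · exact (Submodule.Quotient.norm_mk_le _ _).trans hx.le
        · refine le_of_forall_pos_le_add fun ε hε => ?_
          obtain ⟨w, hw, hw'⟩ := Submodule.Quotient.norm_mk_lt
            (Submodule.Quotient.mk (lpPUnitConst x) :
              BanachUltraproduct (pure PUnit.unit : Ultrafilter PUnit.{u + 1}) (fun _ => E)) hε
          refine le_trans ?_ hw'.le
          have hw0 := (Submodule.Quotient.eq _).1 hw
          have hw1 : Tendsto (fun i => ‖w i - x‖)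
            ((pure PUnit.unit : Ultrafilter PUnit.{u + 1}) : Filter PUnit) (𝓝 0) := hw0
          rw [Ultrafilter.coe_pure] at hw1
          -- the only element of `ultraNull` is `0`, so every representative of the class is `x`
          have hw2 := tendsto_nhds_unique hw1 (tendsto_pure_nhds _ _)
          have hw3 : w PUnit.unit = x := sub_eq_zero.1 (norm_eq_zero.1 hw2.symm)
          rw [← hw3]
          exact lp.norm_apply_le_norm (by simp) w PUnit.unit }
    (fun y => by
      obtain ⟨w, rfl⟩ := Submodule.Quotient.mk_surjective _ y
      exact ⟨w PUnit.unit, rfl⟩)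

theorem eLpNorm_count_ulift {X : Type*} [NormedAddCommGroup X] {q : ℝ≥0∞} (hq0 : q ≠ 0)
    (hq : q ≠ ∞) (f : ℕ → X) :
    eLpNorm (fun i : ULift.{u} ℕ => f i.down) q Measure.count
      = (∑' i, ‖f i‖ₑ ^ q.toReal) ^ (1 / q.toReal) := by
  rw [eLpNorm_eq_lintegral_rpow_enorm_toReal hq0 hq, lintegral_count]
  congr 1
  exact Equiv.tsum_eq Equiv.ulift (fun i => ‖f i‖ₑ ^ q.toReal)

theorem memLp_count_ulift_iff {X : Type*} [NormedAddCommGroup X] {q : ℝ≥0∞} (hq0 : q ≠ 0)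
    (hq : q ≠ ∞) (f : ℕ → X) :
    MemLp (fun i : ULift.{u} ℕ => f i.down) q Measure.count ↔ Memℓp f q := by
  have hq' : 0 < q.toReal := ENNReal.toReal_pos hq0 hq
  have h1 : ∀ i, ‖f i‖ₑ ^ q.toReal = ((‖f i‖₊ ^ q.toReal : NNReal) : ℝ≥0∞) := fun i => by
    rw [enorm_eq_nnnorm, ENNReal.coe_rpow_of_nonneg _ hq'.le]
  rw [memℓp_gen_iff hq', MemLp, eLpNorm_count_ulift hq0 hq,
    ENNReal.rpow_lt_top_iff_of_pos (by positivity), lt_top_iff_ne_top, tsum_congr h1,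
    ENNReal.tsum_coe_ne_top_iff_summable, ← NNReal.summable_coe]
  constructor
  · intro h
    simpa using h.2
  · intro h
    exact ⟨.of_discrete, by simpa using h⟩

/-- The sequence space `ℓ_q(ℕ, X)` is `L_q(X)` of the counting measure. The index set is lifted
to the universe of `X`. -/
noncomputable def lpLinearIsometryEquivLpCount (X : Type u) [NormedAddCommGroup X]
    [NormedSpace ℂ X] (q : ℝ≥0∞) [hq1 : Fact (1 ≤ q)] (hq : q ≠ ∞) :
    lp (fun _ : ℕ => X) q ≃ₗᵢ[ℂ] Lp X q (Measure.count : Measure (ULift.{u} ℕ)) :=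
  have hq0 : q ≠ 0 := (zero_lt_one.trans_le hq1.out).ne'
  LinearIsometryEquiv.ofSurjective
    { toFun z := ((memLp_count_ulift_iff hq0 hq z).2 (lp.memℓp z)).toLp
      map_add' _ _ := rfl
      map_smul' _ _ := rfl
      norm_map' z := by
        have hq' : 0 < q.toReal := ENNReal.toReal_pos hq0 hq
        refine (Lp.norm_toLp (fun i : ULift.{u} ℕ => z i.down)
          ((memLp_count_ulift_iff hq0 hq z).2 (lp.memℓp z))).trans ?_
        rw [eLpNorm_count_ulift hq0 hq, ← ENNReal.toReal_rpow, lp.norm_eq_tsum_rpow hq',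
          ENNReal.tsum_toReal_eq]
        · simp [← ENNReal.toReal_rpow]
        · intro i
          exact ENNReal.rpow_ne_top_of_nonneg hq'.le (by simp) }
    (fun g => by
      have hg := Lp.memLp g
      refine ⟨⟨fun i => g ⟨i⟩, (memLp_count_ulift_iff hq0 hq (fun i => g ⟨i⟩)).1 hg⟩, ?_⟩
      exact Lp.toLp_coeFn g hg)

/-- Every quotient of `ℓ_p(ℕ, X)` is an `SQ_p(X)`-space; the ultraproduct has a single factor. -/
theorem isSQpSpace_quotient_lp {p : ℝ} (hp : 1 ≤ p) (X : Type u) [NormedAddCommGroup X]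
    [NormedSpace ℂ X] [Fact (1 ≤ ENNReal.ofReal p)]
    (N : Submodule ℂ (lp (fun _ : ℕ => X) (ENNReal.ofReal p)))
    [hN : IsClosed (N : Set (lp (fun _ : ℕ => X) (ENNReal.ofReal p)))] :
    IsSQpSpace p hp X (lp (fun _ : ℕ => X) (ENNReal.ofReal p) ⧸ N) :=
  ⟨PUnit, pure PUnit.unit, fun _ => ULift ℕ, fun _ => inferInstance, fun _ => Measure.count,
    isQuotientOfSubspace_of_linearIsometryEquiv
      ((lpLinearIsometryEquivLpCount X _ ENNReal.ofReal_ne_top).trans (ultraproductPUnit _)) N hN⟩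

/-! ### The lower estimate -/

theorem minModulus_nonneg {X : Type*} [NormedAddCommGroup X] [NormedSpace ℂ X]
    (R : X →L[ℂ] X) : 0 ≤ minModulus R :=
  Real.iInf_nonneg fun _ => norm_nonneg _

theorem minModulus_mul_norm_le {X : Type*} [NormedAddCommGroup X] [NormedSpace ℂ X]
    (R : X →L[ℂ] X) (v : X) : minModulus R * ‖v‖ ≤ ‖R v‖ := by
  rcases eq_or_ne v 0 with rfl | hv
  · simp
  have hv' : 0 < ‖v‖ := norm_pos_iff.2 hv
  have h1 : ‖((‖v‖ : ℂ)⁻¹ • v)‖ = 1 := by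
    rw [norm_smul, norm_inv, Complex.norm_real, norm_norm, inv_mul_cancel₀ hv'.ne']
  have h2 : minModulus R ≤ ‖R ((‖v‖ : ℂ)⁻¹ • v)‖ :=
    ciInf_le (f := fun x : Metric.sphere (0 : X) 1 => ‖R (x : X)‖)
      ⟨0, by rintro _ ⟨x, rfl⟩; exact norm_nonneg _⟩ ⟨(‖v‖ : ℂ)⁻¹ • v, by simp [h1]⟩
  rw [map_smul, norm_smul, norm_inv, Complex.norm_real, norm_norm] at h2
  rwa [← le_div_iff₀ hv', div_eq_inv_mul]

/-- Unrolling of the recursive inequality `m i * a i ≤ a (i + 1) + b i`. -/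
theorem le_sum_div_prod_of_mul_le {a b m : ℕ → ℝ} (hm : ∀ i, 0 < m i)
    (h : ∀ i, m i * a i ≤ a (i + 1) + b i) (N : ℕ) :
    a 0 ≤ a N / ∏ i ∈ Finset.range N, m i
      + ∑ i ∈ Finset.range N, b i / ∏ l ∈ Finset.range (i + 1), m l := by
  induction N with
  | zero => simp
  | succ N ih =>
    refine ih.trans ?_
    have hM : 0 < ∏ i ∈ Finset.range N, m i := Finset.prod_pos fun i _ => hm i
    have h1 : a N / ∏ i ∈ Finset.range N, m i
        ≤ (a (N + 1) + b N) / ∏ i ∈ Finset.range (N + 1), m i := by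
      rw [Finset.prod_range_succ, div_le_div_iff₀ hM (mul_pos hM (hm N))]
      nlinarith [mul_le_mul_of_nonneg_left (h N) hM.le]
    rw [Finset.sum_range_succ]
    rw [add_div] at h1
    linarith

/-- The case of Hölder's inequality with geometric weights `2⁻¹, 2⁻², …`, whose sum is at
most `1`. -/
theorem sum_geometric_mul_le {p : ℝ} (hp : 1 ≤ p) (B : ℕ → ℝ) (hB : ∀ i, 0 ≤ B i) (N : ℕ) :
    ∑ i ∈ Finset.range N, B i / (2 : ℝ) ^ (((i : ℝ) + 1) * (p - 1) / p)
      ≤ (∑ i ∈ Finset.range N, B i ^ p) ^ p⁻¹ := by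
  have hp0 : 0 < p := by linarith
  have h := Real.inner_le_weight_mul_Lp_of_nonneg (Finset.range N) hp
    (fun i => (2 : ℝ) ^ (-((i : ℝ) + 1))) (fun i => (2 : ℝ) ^ (((i : ℝ) + 1) * p⁻¹) * B i)
    (fun i => by positivity) (fun i => mul_nonneg (by positivity) (hB i))
  have e1 : ∀ i : ℕ, (2 : ℝ) ^ (-((i : ℝ) + 1)) * ((2 : ℝ) ^ (((i : ℝ) + 1) * p⁻¹) * B i)
      = B i / (2 : ℝ) ^ (((i : ℝ) + 1) * (p - 1) / p) := fun i => by
    rw [← mul_assoc, ← Real.rpow_add two_pos, div_eq_mul_inv, ← Real.rpow_neg two_pos.le, mul_comm]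
    congr 2
    field_simp
    ring
  have e2 : ∀ i : ℕ, (2 : ℝ) ^ (-((i : ℝ) + 1)) * ((2 : ℝ) ^ (((i : ℝ) + 1) * p⁻¹) * B i) ^ p
      = B i ^ p := fun i => by
    rw [Real.mul_rpow (by positivity) (hB i), ← Real.rpow_mul two_pos.le, ← mul_assoc,
      ← Real.rpow_add two_pos, inv_mul_cancel_right₀ hp0.ne', neg_add_cancel, Real.rpow_zero,
      one_mul]
  have e3 (N : ℕ) : ∑ i ∈ Finset.range N, (2 : ℝ) ^ (-((i : ℝ) + 1)) = 1 - (2 : ℝ) ^ (-(N : ℝ)) := by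
    induction N with
    | zero => simp
    | succ N ih =>
      have h2 : (2 : ℝ) ^ (-(N : ℝ)) = 2 * (2 : ℝ) ^ (-((N : ℝ) + 1)) := by
        rw [neg_add, Real.rpow_add two_pos, Real.rpow_neg_one]
        ring
      rw [Finset.sum_range_succ, ih, h2]
      push_cast
      ring
  simp only [e1, e2] at h
  refine h.trans (mul_le_of_le_one_left (Real.rpow_nonneg
    (Finset.sum_nonneg fun i _ => Real.rpow_nonneg (hB i) _) _) (Real.rpow_le_one ?_ ?_ ?_))
  · exact Finset.sum_nonneg fun i _ => by positivity
  · rw [e3]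
    have : 0 < (2 : ℝ) ^ (-(N : ℝ)) := by positivity
    linarith
  · rw [sub_nonneg]
    exact inv_le_one_of_one_le₀ hp

/-- Hölder's inequality for a finite sum, with the constant function `1`. -/
theorem sum_le_card_rpow_mul {ι : Type*} {p : ℝ} (hp : 1 ≤ p) (s : Finset ι) (f : ι → ℝ)
    (hf : ∀ i, 0 ≤ f i) :
    ∑ i ∈ s, f i ≤ (s.card : ℝ) ^ ((p - 1) / p) * (∑ i ∈ s, f i ^ p) ^ p⁻¹ := by
  have h := Real.inner_le_weight_mul_Lp_of_nonneg s hp (fun _ => 1) f (fun _ => zero_le_one) hf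
  have e : 1 - p⁻¹ = (p - 1) / p := by field_simp
  simpa [e] using h

theorem add_le_two_rpow_mul {p : ℝ} (hp : 1 ≤ p) {a b : ℝ} (ha : 0 ≤ a) (hb : 0 ≤ b) :
    a + b ≤ (2 : ℝ) ^ ((p - 1) / p) * (a ^ p + b ^ p) ^ p⁻¹ := by
  simpa using sum_le_card_rpow_mul hp Finset.univ ![a, b]
    (fun i => by fin_cases i <;> simp [ha, hb])

/-- A sum over `(0, k N]` splits along the blocks `(k i, k (i + 1)]`. -/
theorem sum_Ioc_blocks {M : Type*} [AddCommMonoid M] {k : ℕ → ℕ} (hk : StrictMono k)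
    (h0 : k 0 = 0) (f : ℕ → M) (N : ℕ) :
    ∑ j ∈ Finset.Ioc 0 (k N), f j
      = ∑ i ∈ Finset.range N, ∑ j ∈ Finset.Ioc (k i) (k (i + 1)), f j := by
  induction N with
  | zero => simp [h0]
  | succ N ih =>
    rw [Finset.sum_range_succ, ← ih,
      Finset.sum_Ioc_consecutive f (Nat.zero_le _) (hk (Nat.lt_succ_self N)).le]

section LowerEstimate

variable {X : Type*} [NormedAddCommGroup X] [NormedSpace ℂ X] {p : ℝ} {c : ℕ → ℝ}
  {T : X →L[ℂ] X} {k : ℕ → ℕ}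

/-- Hölder's inequality on one block `(k n, k (n + 1)]`. The factor
`(k (n + 1) - k n) ^ ((p - 1) / p)` of the condition pays for the number of terms. -/
theorem norm_block_le (hp : 1 ≤ p) (hpos : ∀ j, 1 ≤ j → 0 < c j) (hk : StrictMono k)
    (n : ℕ) (hstar : ∀ j : ℕ, k n < j → j ≤ k (n + 1) →
      (2 : ℝ) ^ (((n : ℝ) + 1) * (p - 1) / p) * ((k (n + 1) : ℝ) - (k n : ℝ)) ^ ((p - 1) / p)
          * ‖T ^ (k (n + 1) - j)‖
        ≤ c j * ∏ i ∈ Finset.range (n + 1), minModulus (T ^ (k (i + 1) - k i))) (z : ℕ → X) :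
    (2 : ℝ) ^ (((n : ℝ) + 1) * (p - 1) / p)
        * ‖∑ j ∈ Finset.Ioc (k n) (k (n + 1)), (T ^ (k (n + 1) - j)) (z j)‖
      ≤ (∏ i ∈ Finset.range (n + 1), minModulus (T ^ (k (i + 1) - k i)))
        * (∑ j ∈ Finset.Ioc (k n) (k (n + 1)), (c j * ‖z j‖) ^ p) ^ p⁻¹ := by
  set M := ∏ i ∈ Finset.range (n + 1), minModulus (T ^ (k (i + 1) - k i))
  set A := (2 : ℝ) ^ (((n : ℝ) + 1) * (p - 1) / p)
  set s := Finset.Ioc (k n) (k (n + 1)) with hs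
  have hM0 : 0 ≤ M := Finset.prod_nonneg fun i _ => minModulus_nonneg _
  have hd : ((s.card : ℕ) : ℝ) = (k (n + 1) : ℝ) - (k n : ℝ) := by
    rw [hs, Nat.card_Ioc, Nat.cast_sub (hk (Nat.lt_succ_self n)).le]
  have hd0 : 0 < ((s.card : ℕ) : ℝ) := by
    rw [hd, sub_pos]
    exact_mod_cast hk (Nat.lt_succ_self n)
  rw [← hd] at hstar
  set D := ((s.card : ℕ) : ℝ) ^ ((p - 1) / p) with hD
  have hD0 : 0 < D := Real.rpow_pos_of_pos hd0 _
  -- outside the block `c j` need not be positive, hence the absolute value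
  have hcz : ∀ j ∈ s, c j * ‖z j‖ = |c j| * ‖z j‖ := fun j hj => by
    rw [abs_of_pos (hpos j (by have := (Finset.mem_Ioc.1 hj).1; omega))]
  have h1 : A * D * ‖∑ j ∈ s, (T ^ (k (n + 1) - j)) (z j)‖ ≤ M * ∑ j ∈ s, |c j| * ‖z j‖ := by
    have h0 : 0 ≤ A * D := by positivity
    refine (mul_le_mul_of_nonneg_left (norm_sum_le _ _) h0).trans ?_
    rw [Finset.mul_sum, Finset.mul_sum]
    refine Finset.sum_le_sum fun j hj => ?_
    have hj' := Finset.mem_Ioc.1 hj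
    calc A * D * ‖(T ^ (k (n + 1) - j)) (z j)‖
        ≤ A * D * (‖T ^ (k (n + 1) - j)‖ * ‖z j‖) :=
          mul_le_mul_of_nonneg_left (ContinuousLinearMap.le_opNorm _ _) h0
      _ = A * D * ‖T ^ (k (n + 1) - j)‖ * ‖z j‖ := by ring
      _ ≤ c j * M * ‖z j‖ :=
          mul_le_mul_of_nonneg_right (hstar j hj'.1 hj'.2) (norm_nonneg _)
      _ = M * (|c j| * ‖z j‖) := by rw [← hcz j hj]; ring
  have h2 := sum_le_card_rpow_mul hp s (fun j => |c j| * ‖z j‖) (fun j => by positivity)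
  rw [← hD] at h2
  have h3 : A * D * ‖∑ j ∈ s, (T ^ (k (n + 1) - j)) (z j)‖
      ≤ M * (D * (∑ j ∈ s, (|c j| * ‖z j‖) ^ p) ^ p⁻¹) :=
    h1.trans (mul_le_mul_of_nonneg_left h2 hM0)
  rw [Finset.sum_congr rfl fun j hj => congrArg (· ^ p) (hcz j hj)]
  refine le_of_mul_le_mul_left ?_ hD0
  linarith

/-- If `y` is, formally, `∑ S⁻ʲ (z j)` over `0 < j ≤ k N`, then its norm is at most the weighted
`ℓ_p`-norm of `z`. The identity is solved backwards block by block, at each block losing the factor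
`1 / m(T ^ (k (i + 1) - k i))`; the powers of `2` in the condition make the block estimates
summable. -/
theorem norm_le_of_pow_eq_sum (hp : 1 ≤ p) (hpos : ∀ j, 1 ≤ j → 0 < c j) (hk : StrictMono k)
    (hk0 : k 0 = 0) (hstar : ∀ n j : ℕ, k n < j → j ≤ k (n + 1) →
      (2 : ℝ) ^ (((n : ℝ) + 1) * (p - 1) / p) * ((k (n + 1) : ℝ) - (k n : ℝ)) ^ ((p - 1) / p)
          * ‖T ^ (k (n + 1) - j)‖
        ≤ c j * ∏ i ∈ Finset.range (n + 1), minModulus (T ^ (k (i + 1) - k i)))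
    (y : X) (z : ℕ → X) (N : ℕ)
    (h : (T ^ k N) y = ∑ j ∈ Finset.Ioc 0 (k N), (T ^ (k N - j)) (z j)) :
    ‖y‖ ≤ (∑ j ∈ Finset.Ioc 0 (k N), (c j * ‖z j‖) ^ p) ^ p⁻¹ := by
  -- in the zero space the unit sphere is empty and every minimum modulus is `0`
  rcases subsingleton_or_nontrivial X with hX | hX
  · rw [Subsingleton.elim y 0, norm_zero]
    refine Real.rpow_nonneg (Finset.sum_nonneg fun j hj => Real.rpow_nonneg ?_ _) _
    exact mul_nonneg (hpos j (Finset.mem_Ioc.1 hj).1).le (norm_nonneg _)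
  have hkk : ∀ i, k i < k (i + 1) := fun i => hk (Nat.lt_succ_self i)
  have hM : ∀ n, 0 < ∏ i ∈ Finset.range (n + 1), minModulus (T ^ (k (i + 1) - k i)) := by
    intro n
    -- the inequality for the last index of the block, where the power of `T` is `1`
    have h1 := hstar n (k (n + 1)) (hkk n) le_rfl
    rw [Nat.sub_self, pow_zero, norm_one, mul_one] at h1
    have h2 : (0 : ℝ) < (k (n + 1) : ℝ) - (k n : ℝ) := by
      rw [sub_pos]; exact_mod_cast hkk n
    have h3 : 0 < c (k (n + 1)) := hpos _ (by have := hkk n; omega)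
    exact pos_of_mul_pos_right (lt_of_lt_of_le (by positivity) h1) h3.le
  have hm : ∀ i, 0 < minModulus (T ^ (k (i + 1) - k i)) := fun i =>
    (minModulus_nonneg _).lt_of_ne' fun h0 =>
      (hM i).ne' (Finset.prod_eq_zero (Finset.self_mem_range_succ i) h0)
  let b : ℕ → X := fun i => ∑ j ∈ Finset.Ioc (k i) (k (i + 1)), (T ^ (k (i + 1) - j)) (z j)
  -- `v i` is the remainder after the blocks before `i`; it goes from `y` to `0`
  let v : ℕ → X := fun i => (T ^ k i) y - ∑ j ∈ Finset.Ioc 0 (k i), (T ^ (k i - j)) (z j)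
  have hpow : ∀ {a b : ℕ} (_ : a ≤ b) (x : X), (T ^ (b - a)) ((T ^ a) x) = (T ^ b) x := by
    intro a b hab x
    rw [← mul_apply_eq_comp, ← pow_add, Nat.sub_add_cancel hab]
  have hv : ∀ i, (T ^ (k (i + 1) - k i)) (v i) = v (i + 1) + b i := by
    intro i
    simp only [v, b]
    rw [map_sub, hpow (hkk i).le, map_sum,
      ← Finset.sum_Ioc_consecutive _ (Nat.zero_le (k i)) (hkk i).le, ← sub_sub, sub_add_cancel]
    congr 1
    refine Finset.sum_congr rfl fun j hj => ?_
    have hj' := Finset.mem_Ioc.1 hj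
    have := hkk i
    rw [← mul_apply_eq_comp, ← pow_add]
    congr 2
    omega
  have hstep : ∀ i, minModulus (T ^ (k (i + 1) - k i)) * ‖v i‖ ≤ ‖v (i + 1)‖ + ‖b i‖ := fun i =>
    (minModulus_mul_norm_le _ _).trans (by rw [hv i]; exact norm_add_le _ _)
  have hmain := le_sum_div_prod_of_mul_le (a := fun i => ‖v i‖) (b := fun i => ‖b i‖) hm hstep N
  have hv0 : v 0 = y := by simp [v, hk0]
  have hvN : v N = 0 := by simp only [v]; rw [h, sub_self]
  simp only [hv0, hvN, norm_zero, zero_div, zero_add] at hmain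
  let B : ℕ → ℝ := fun i => (∑ j ∈ Finset.Ioc (k i) (k (i + 1)), (c j * ‖z j‖) ^ p) ^ p⁻¹
  have hS : ∀ i, 0 ≤ ∑ j ∈ Finset.Ioc (k i) (k (i + 1)), (c j * ‖z j‖) ^ p := fun i =>
    Finset.sum_nonneg fun j hj => Real.rpow_nonneg (mul_nonneg
      (hpos j (by have := (Finset.mem_Ioc.1 hj).1; omega)).le (norm_nonneg _)) _
  have hB : ∀ i, ‖b i‖ / ∏ l ∈ Finset.range (i + 1), minModulus (T ^ (k (l + 1) - k l))
      ≤ B i / (2 : ℝ) ^ (((i : ℝ) + 1) * (p - 1) / p) := fun i => by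
    rw [div_le_div_iff₀ (hM i) (by positivity)]
    have := norm_block_le hp hpos hk i (hstar i) z
    simp only [b, B]
    linarith
  refine hmain.trans ((Finset.sum_le_sum fun i _ => hB i).trans ?_)
  refine (sum_geometric_mul_le hp B (fun i => Real.rpow_nonneg (hS i) _) N).trans ?_
  rw [sum_Ioc_blocks hk hk0]
  refine le_of_eq ?_
  congr 1
  refine Finset.sum_congr rfl fun i _ => ?_
  exact Real.rpow_inv_rpow (hS i) (by linarith)

end LowerEstimate

/-! ### Weighted shifts on sequence spaces -/

section Shift

variable {X : Type*} [NormedAddCommGroup X] [NormedSpace ℂ X] {q : ℝ≥0∞}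

/-- The estimate behind all operators on sequence spaces below: `g` is, in norm, dominated by `C`
times the sequence `f` moved `j` places to the right. -/
theorem summable_rpow_and_tsum_le_of_shift {X : Type*} [NormedAddCommGroup X] {q : ℝ≥0∞}
    (hq : 0 < q.toReal) {f g : ℕ → X} {j : ℕ} {C : ℝ} (hC : 0 ≤ C)
    (h0 : ∀ i < j, g i = 0) (h1 : ∀ i, ‖g (i + j)‖ ≤ C * ‖f i‖)
    (hf : Summable fun i => ‖f i‖ ^ q.toReal) :
    Summable (fun i => ‖g i‖ ^ q.toReal) ∧
      ∑' i, ‖g i‖ ^ q.toReal ≤ C ^ q.toReal * ∑' i, ‖f i‖ ^ q.toReal := by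
  have h2 : ∀ i, ‖g (i + j)‖ ^ q.toReal ≤ C ^ q.toReal * ‖f i‖ ^ q.toReal := fun i => by
    rw [← Real.mul_rpow hC (norm_nonneg _)]
    exact Real.rpow_le_rpow (norm_nonneg _) (h1 i) hq.le
  have h3 : Summable fun i => ‖g (i + j)‖ ^ q.toReal :=
    Summable.of_nonneg_of_le (fun i => by positivity) h2 (hf.mul_left _)
  have h4 := (summable_nat_add_iff (f := fun i => ‖g i‖ ^ q.toReal) j).1 h3
  refine ⟨h4, ?_⟩
  rw [← h4.sum_add_tsum_nat_add j, Finset.sum_eq_zero, zero_add, ← tsum_mul_left]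
  · exact h3.tsum_le_tsum h2 (hf.mul_left _)
  · intro i hi
    rw [h0 i (Finset.mem_range.1 hi), norm_zero, Real.zero_rpow hq.ne']

theorem lp.norm_le_of_shift {X : Type*} [NormedAddCommGroup X] {q : ℝ≥0∞}
    (hq : 0 < q.toReal) {f g : lp (fun _ : ℕ => X) q} {j : ℕ} {C : ℝ}
    (hC : 0 ≤ C) (h0 : ∀ i < j, g i = 0) (h1 : ∀ i, ‖g (i + j)‖ ≤ C * ‖f i‖) :
    ‖g‖ ≤ C * ‖f‖ := by
  have h := (summable_rpow_and_tsum_le_of_shift hq hC h0 h1 ((lp.memℓp f).summable hq)).2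
  rw [← lp.norm_rpow_eq_tsum hq, ← lp.norm_rpow_eq_tsum hq,
    ← Real.mul_rpow hC (lp.norm_nonneg' _)] at h
  exact (Real.rpow_le_rpow_iff (lp.norm_nonneg' _) (mul_nonneg hC (lp.norm_nonneg' _)) hq).1 h

/-- The operator on `ℓ_q(ℕ, X)` that moves each coordinate `j` places to the right and applies the
operator `g i` to the `i`-th one. -/
noncomputable def lpShift [Fact (1 ≤ q)] (hq : q ≠ ∞) (j : ℕ) (g : ℕ → X →L[ℂ] X) (C : ℝ)
    (hg : ∀ i, ‖g i‖ ≤ C) : lp (fun _ : ℕ => X) q →L[ℂ] lp (fun _ : ℕ => X) q :=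
  have hq' : 0 < q.toReal :=
    ENNReal.toReal_pos (zero_lt_one.trans_le (Fact.out : 1 ≤ q)).ne' hq
  have hC : 0 ≤ C := (norm_nonneg _).trans (hg 0)
  have h0 (z : lp (fun _ : ℕ => X) q) (i : ℕ) (hi : i < j) :
      (if j ≤ i then g (i - j) (z (i - j)) else 0) = 0 := if_neg (by omega)
  have h1 (z : lp (fun _ : ℕ => X) q) (i : ℕ) :
      ‖(if j ≤ i + j then g (i + j - j) (z (i + j - j)) else 0)‖ ≤ C * ‖z i‖ := by
    rw [if_pos (Nat.le_add_left _ _), Nat.add_sub_cancel]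
    exact (g i).le_of_opNorm_le (hg i) _
  LinearMap.mkContinuous
    { toFun z := ⟨fun i => if j ≤ i then g (i - j) (z (i - j)) else 0, memℓp_gen
        (summable_rpow_and_tsum_le_of_shift hq' hC (h0 z) (h1 z) ((lp.memℓp z).summable hq')).1⟩
      map_add' y z := by
        ext i
        simp only [lp.coeFn_add, Pi.add_apply, map_add]
        split_ifs <;> simp
      map_smul' a z := by
        ext i
        simp only [lp.coeFn_smul, Pi.smul_apply, map_smul, RingHom.id_apply]
        split_ifs <;> simp } C
    (fun z => lp.norm_le_of_shift hq' hC (h0 z) (h1 z))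

variable [Fact (1 ≤ q)] (hq : q ≠ ∞)

theorem lpShift_apply (j : ℕ) (g : ℕ → X →L[ℂ] X) (C : ℝ) (hg : ∀ i, ‖g i‖ ≤ C)
    (z : lp (fun _ : ℕ => X) q) (i : ℕ) :
    lpShift hq j g C hg z i = if j ≤ i then g (i - j) (z (i - j)) else 0 := rfl

theorem lpShift_single (j : ℕ) (g : ℕ → X →L[ℂ] X) (C : ℝ) (hg : ∀ i, ‖g i‖ ≤ C) (i : ℕ) (x : X) :
    lpShift hq j g C hg (lp.single q i x) = lp.single q (i + j) (g i x) := by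
  ext l
  rw [lpShift_apply, lp.single_apply, lp.single_apply]
  rcases eq_or_ne l (i + j) with rfl | hl
  · rw [if_pos (Nat.le_add_left _ _), Nat.add_sub_cancel, Pi.single_eq_same, Pi.single_eq_same]
  · rw [Pi.single_eq_of_ne hl]
    split_ifs with h
    · rw [Pi.single_eq_of_ne (by omega), map_zero]
    · rfl

/-- The coordinatewise action of an operator on a sequence space. -/
noncomputable def lpDiag (R : X →L[ℂ] X) : lp (fun _ : ℕ => X) q →L[ℂ] lp (fun _ : ℕ => X) q :=
  lpShift hq 0 (fun _ => R) ‖R‖ (fun _ => le_rfl)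

theorem lpDiag_apply (R : X →L[ℂ] X) (z : lp (fun _ : ℕ => X) q) (i : ℕ) :
    lpDiag hq R z i = R (z i) := by
  simp [lpDiag, lpShift_apply]

theorem lpDiag_single (R : X →L[ℂ] X) (i : ℕ) (x : X) :
    lpDiag hq R (lp.single q i x) = lp.single q i (R x) :=
  lpShift_single hq 0 _ _ _ i x

theorem lpDiag_mul_apply (R R' : X →L[ℂ] X) (z : lp (fun _ : ℕ => X) q) :
    lpDiag hq R (lpDiag hq R' z) = lpDiag hq (R * R') z := by
  ext i
  simp only [lpDiag_apply, mul_apply_eq_comp]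

theorem lpDiag_one : lpDiag hq (1 : X →L[ℂ] X) = 1 := by
  ext z i
  simp only [lpDiag_apply, one_apply_eq_self]

theorem norm_lpDiag_apply_le (R : X →L[ℂ] X) (z : lp (fun _ : ℕ => X) q) :
    ‖lpDiag hq R z‖ ≤ ‖R‖ * ‖z‖ :=
  lp.norm_le_of_shift (ENNReal.toReal_pos (zero_lt_one.trans_le (Fact.out : 1 ≤ q)).ne' hq)
    (norm_nonneg R) (j := 0) (by simp) fun i => by
      rw [add_zero, lpDiag_apply]
      exact R.le_opNorm _

/-- A closed submodule of `ℓ_q(ℕ, X)`, `q < ∞`, that contains all one-term sequences is the whole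
space. -/
theorem lp.mem_of_single_mem {X : Type*} [NormedAddCommGroup X] [NormedSpace ℂ X] {q : ℝ≥0∞}
    [Fact (1 ≤ q)] (hq : q ≠ ∞) (N : Submodule ℂ (lp (fun _ : ℕ => X) q))
    (hN : IsClosed (N : Set (lp (fun _ : ℕ => X) q))) (h : ∀ i x, lp.single q i x ∈ N)
    (z : lp (fun _ : ℕ => X) q) : z ∈ N :=
  hN.mem_of_tendsto (lp.hasSum_single hq z)
    (Eventually.of_forall fun _ => N.sum_mem fun i _ => h i _)

end Shift

/-! ### Operators on quotients -/

section QuotientOperator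

variable {Z : Type*} [NormedAddCommGroup Z] [NormedSpace ℂ Z] {N : Submodule ℂ Z}

/-- An operator on a quotient is bounded by any bound for a map that lifts it. -/
theorem Submodule.norm_clm_quotient_le [IsClosed (N : Set Z)] {A : Z → Z}
    {B : (Z ⧸ N) →L[ℂ] (Z ⧸ N)}
    (hB : ∀ z, B (Submodule.Quotient.mk z) = Submodule.Quotient.mk (A z))
    {C : ℝ} (hC : 0 ≤ C) (hA : ∀ z, ‖A z‖ ≤ C * ‖z‖) : ‖B‖ ≤ C := by
  refine B.opNorm_le_bound hC fun y => ?_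
  refine le_of_forall_pos_le_add fun ε hε => ?_
  obtain ⟨z, rfl, hz⟩ := Submodule.Quotient.norm_mk_lt y (ε := ε / (C + 1)) (by positivity)
  rw [hB]
  refine (Submodule.Quotient.norm_mk_le _ _).trans ((hA z).trans ?_)
  have h1 : C * ‖z‖ ≤ C * (‖(Submodule.Quotient.mk z : Z ⧸ N)‖ + ε / (C + 1)) :=
    mul_le_mul_of_nonneg_left hz.le hC
  have h2 : C * (ε / (C + 1)) ≤ ε := by
    rw [mul_div_assoc', div_le_iff₀ (by positivity)]
    nlinarith
  linarith

/-- The operator induced on the quotient by an invariant subspace. -/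
def quotientOperator (A : Z →L[ℂ] Z) (hA : ∀ z ∈ N, A z ∈ N) : (Z ⧸ N) →L[ℂ] (Z ⧸ N) :=
  N.liftQL (N.mkQL ∘L A) fun z hz => (Submodule.Quotient.mk_eq_zero N).2 (hA z hz)

theorem quotientOperator_mk (A : Z →L[ℂ] Z) (hA : ∀ z ∈ N, A z ∈ N) (z : Z) :
    quotientOperator A hA (Submodule.Quotient.mk z) = Submodule.Quotient.mk (A z) := rfl

theorem quotientOperator_pow_mk (A : Z →L[ℂ] Z) (hA : ∀ z ∈ N, A z ∈ N) (j : ℕ) (z : Z) :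
    (quotientOperator A hA ^ j) (Submodule.Quotient.mk z) = Submodule.Quotient.mk ((A ^ j) z) := by
  induction j with
  | zero => rfl
  | succ j ih =>
    rw [pow_succ', pow_succ', mul_apply_eq_comp, ih, quotientOperator_mk, mul_apply_eq_comp]

theorem Submodule.map_topologicalClosure_mem {A : Z →L[ℂ] Z} (hA : ∀ z ∈ N, A z ∈ N) :
    ∀ z ∈ N.topologicalClosure, A z ∈ N.topologicalClosure := fun _ hz =>
  map_mem_closure A.continuous hz hA

end QuotientOperator

/-! ### The space of formal backward orbits -/

section Orbits

variable {X : Type*} [NormedAddCommGroup X] [NormedSpace ℂ X] {q : ℝ≥0∞}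
  (T : X →L[ℂ] X) (w : ℕ → ℝ)

/-- The weighted right shift: in terms of the vectors `y i = (w i)⁻¹ • z i` it sends
`(y 0, y 1, …)` to `(0, y 0, y 1, …)`. -/
noncomputable def weightedShift [Fact (1 ≤ q)] (hq : q ≠ ∞) (C : ℝ)
    (hC : ∀ i, |w (i + 1) / w i| ≤ C) : lp (fun _ : ℕ => X) q →L[ℂ] lp (fun _ : ℕ => X) q :=
  lpShift hq 1 (fun i => ((w (i + 1) / w i : ℝ) : ℂ) • ContinuousLinearMap.id ℂ X) C fun i => by
    rw [norm_smul, Complex.norm_real, Real.norm_eq_abs]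
    exact (mul_le_of_le_one_right (abs_nonneg _) ContinuousLinearMap.norm_id_le).trans (hC i)

/-- The relations `S⁻ʲ x = S⁻ʲ⁻¹ T x`, where the coefficient vector `x` of `S⁻ʲ` is recorded
by the one-term sequence `w j • x` at the place `j`. -/
noncomputable def orbitRelations (q : ℝ≥0∞) : Submodule ℂ (lp (fun _ : ℕ => X) q) :=
  Submodule.span ℂ (Set.range fun a : ℕ × X =>
    lp.single q a.1 ((w a.1 : ℂ) • a.2) - lp.single q (a.1 + 1) ((w (a.1 + 1) : ℂ) • T a.2))

variable {T w}

/-- Evaluating a relation `∑ S⁻ʲ y j = 0` after multiplication by a large power of `S = T`. The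
equality for all large `m` makes the statement stable under sums, whatever the injectivity of `T`. -/
theorem orbitRelations_sum_eq_zero (hw : ∀ i, 0 < w i) {z : lp (fun _ : ℕ => X) q}
    (hz : z ∈ orbitRelations T w q) :
    ∃ n, ∀ m, n ≤ m → ∑ j ∈ Finset.range (m + 1), (T ^ (m - j)) ((w j : ℂ)⁻¹ • z j) = 0 := by
  induction hz using Submodule.span_induction with
  | mem z hz =>
    obtain ⟨⟨i, x⟩, rfl⟩ := hz
    refine ⟨i + 1, fun m hm => ?_⟩
    have hi : (w i : ℂ) ≠ 0 := by exact_mod_cast (hw i).ne'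
    have hi1 : (w (i + 1) : ℂ) ≠ 0 := by exact_mod_cast (hw (i + 1)).ne'
    simp only [lp.coeFn_sub, Pi.sub_apply, lp.single_apply, smul_sub, map_sub,
      Finset.sum_sub_distrib]
    rw [Finset.sum_eq_single_of_mem i (by simp; omega), Finset.sum_eq_single_of_mem (i + 1)
      (by simp; omega), Pi.single_eq_same, Pi.single_eq_same, inv_smul_smul₀ hi,
      inv_smul_smul₀ hi1, ← mul_apply_eq_comp (T ^ _) T, ← pow_succ, sub_eq_zero]
    · congr 2
      omega
    · intro j _ hj
      rw [Pi.single_eq_of_ne hj, smul_zero, map_zero]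
    · intro j _ hj
      rw [Pi.single_eq_of_ne hj, smul_zero, map_zero]
  | zero => exact ⟨0, fun m _ => by simp⟩
  | add y z _ _ hy hz =>
    obtain ⟨n₁, h₁⟩ := hy
    obtain ⟨n₂, h₂⟩ := hz
    refine ⟨max n₁ n₂, fun m hm => ?_⟩
    simp only [lp.coeFn_add, Pi.add_apply, smul_add, map_add, Finset.sum_add_distrib]
    rw [h₁ m (le_of_max_le_left hm), h₂ m (le_of_max_le_right hm), add_zero]
  | smul a z _ hz =>
    obtain ⟨n, h⟩ := hz
    refine ⟨n, fun m hm => ?_⟩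
    have : ∀ j, (T ^ (m - j)) ((w j : ℂ)⁻¹ • (a • z) j)
        = a • (T ^ (m - j)) ((w j : ℂ)⁻¹ • z j) := fun j => by
      rw [lp.coeFn_smul, Pi.smul_apply, smul_comm, map_smul]
    rw [Finset.sum_congr rfl fun j _ => this j, ← Finset.smul_sum, h m hm, smul_zero]

theorem orbitRelations_map_mem [Fact (1 ≤ q)]
    {A : lp (fun _ : ℕ => X) q →L[ℂ] lp (fun _ : ℕ => X) q}
    (hA : ∀ (j : ℕ) (x : X),
      A (lp.single q j ((w j : ℂ) • x) - lp.single q (j + 1) ((w (j + 1) : ℂ) • T x))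
      ∈ orbitRelations T w q) :
    ∀ z ∈ orbitRelations T w q, A z ∈ orbitRelations T w q := by
  intro z hz
  induction hz using Submodule.span_induction with
  | mem z hz =>
    obtain ⟨⟨j, x⟩, rfl⟩ := hz
    exact hA j x
  | zero => rw [map_zero]; exact Submodule.zero_mem _
  | add y z _ _ hy hz => rw [map_add]; exact Submodule.add_mem _ hy hz
  | smul a z _ hz => rw [map_smul]; exact Submodule.smul_mem _ a hz

theorem lpDiag_mem_orbitRelations [Fact (1 ≤ q)] (hq : q ≠ ∞) {R : X →L[ℂ] X}
    (hR : R * T = T * R) : ∀ z ∈ orbitRelations T w q, lpDiag hq R z ∈ orbitRelations T w q := by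
  refine orbitRelations_map_mem fun j x => ?_
  refine Submodule.subset_span ⟨(j, R x), ?_⟩
  have h : T (R x) = R (T x) := (DFunLike.congr_fun hR x).symm
  simp only [map_sub, lpDiag_single, map_smul, h]

variable [Fact (1 ≤ q)] (hq : q ≠ ∞) {C : ℝ} (hC : ∀ i, |w (i + 1) / w i| ≤ C)

theorem weightedShift_apply (z : lp (fun _ : ℕ => X) q) (i : ℕ) :
    weightedShift w hq C hC z i
      = if 1 ≤ i then ((w (i - 1 + 1) / w (i - 1) : ℝ) : ℂ) • z (i - 1) else 0 := rfl

theorem weightedShift_single (hw : ∀ i, 0 < w i) (i : ℕ) (x : X) :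
    weightedShift w hq C hC (lp.single q i ((w i : ℂ) • x))
      = lp.single q (i + 1) ((w (i + 1) : ℂ) • x) := by
  rw [weightedShift, lpShift_single]
  congr 1
  have : (w i : ℂ) ≠ 0 := by exact_mod_cast (hw i).ne'
  simp only [smul_apply, ContinuousLinearMap.id_apply, smul_smul]
  push_cast
  rw [div_mul_cancel₀ _ this]

theorem weightedShift_pow_single_zero (hw : ∀ i, 0 < w i) (j : ℕ) (x : X) :
    (weightedShift w hq C hC ^ j) (lp.single q 0 ((w 0 : ℂ) • x))
      = lp.single q j ((w j : ℂ) • x) := by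
  induction j with
  | zero => rfl
  | succ j ih => rw [pow_succ', mul_apply_eq_comp, ih, weightedShift_single hq hC hw]

theorem weightedShift_mem_orbitRelations (hw : ∀ i, 0 < w i) :
    ∀ z ∈ orbitRelations T w q, weightedShift w hq C hC z ∈ orbitRelations T w q := by
  refine orbitRelations_map_mem fun j x => ?_
  rw [map_sub, weightedShift_single hq hC hw, weightedShift_single hq hC hw]
  exact Submodule.subset_span ⟨(j + 1, x), rfl⟩

theorem weightedShift_lpDiag_comm (R : X →L[ℂ] X) (z : lp (fun _ : ℕ => X) q) :
    weightedShift w hq C hC (lpDiag hq R z) = lpDiag hq R (weightedShift w hq C hC z) := by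
  ext i
  rw [lpDiag_apply, weightedShift_apply, weightedShift_apply, lpDiag_apply]
  split_ifs <;> simp

theorem weightedShift_pow_apply_of_lt (j : ℕ) (z : lp (fun _ : ℕ => X) q) (i : ℕ) (hi : i < j) :
    (weightedShift w hq C hC ^ j) z i = 0 := by
  induction j generalizing i with
  | zero => omega
  | succ j ih =>
    rw [pow_succ', mul_apply_eq_comp, weightedShift_apply]
    split_ifs with h
    · rw [ih (i - 1) (by omega), smul_zero]
    · rfl

theorem weightedShift_pow_apply_add (hw : ∀ i, 0 < w i) (j : ℕ) (z : lp (fun _ : ℕ => X) q)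
    (i : ℕ) : (weightedShift w hq C hC ^ j) z (i + j) = ((w (i + j) / w i : ℝ) : ℂ) • z i := by
  induction j with
  | zero => simp [div_self (hw i).ne']
  | succ j ih =>
    rw [pow_succ', mul_apply_eq_comp, weightedShift_apply, if_pos (by omega)]
    have : (w (i + j) : ℂ) ≠ 0 := by exact_mod_cast (hw (i + j)).ne'
    simp only [← add_assoc, Nat.add_sub_cancel, ih, smul_smul]
    push_cast
    rw [div_mul_div_cancel₀ this]

/-- Submultiplicativity of the weight bounds the powers of the weighted shift. -/
theorem norm_weightedShift_pow_apply_le (hw : ∀ i, 0 < w i)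
    (hsub : ∀ i j, w (i + j) ≤ w j * w i) (j : ℕ) (z : lp (fun _ : ℕ => X) q) :
    ‖(weightedShift w hq C hC ^ j) z‖ ≤ w j * ‖z‖ := by
  refine lp.norm_le_of_shift
    (ENNReal.toReal_pos (zero_lt_one.trans_le (Fact.out : 1 ≤ q)).ne' hq) (hw j).le
    (weightedShift_pow_apply_of_lt hq hC j z) fun i => ?_
  rw [weightedShift_pow_apply_add hq hC hw, norm_smul, Complex.norm_real, Real.norm_of_nonneg
    (div_pos (hw _) (hw i)).le]
  exact mul_le_mul_of_nonneg_right ((div_le_iff₀ (hw i)).2 (hsub i j)) (norm_nonneg _)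

/-- On the quotient by the closed relations, the shift and the diagonal action of `T` are inverse to
each other. -/
theorem weightedShift_lpDiag_sub_mem (hw : ∀ i, 0 < w i) (z : lp (fun _ : ℕ => X) q) :
    weightedShift w hq C hC (lpDiag hq T z) - z ∈ (orbitRelations T w q).topologicalClosure := by
  have h := lp.mem_of_single_mem hq ((orbitRelations T w q).topologicalClosure.comap
    ((weightedShift w hq C hC * lpDiag hq T - 1 :
      lp (fun _ : ℕ => X) q →L[ℂ] lp (fun _ : ℕ => X) q) : _ →ₗ[ℂ] _)) ?_ ?_ z
  · exact h
  · exact (Submodule.isClosed_topologicalClosure _).preimage (ContinuousLinearMap.continuous _)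
  · intro i x
    refine Submodule.le_topologicalClosure _ ?_
    change weightedShift w hq C hC (lpDiag hq T (lp.single q i x)) - lp.single q i x ∈ _
    have hwi : (w i : ℂ) ≠ 0 := by exact_mod_cast (hw i).ne'
    obtain ⟨y, rfl⟩ : ∃ y, (w i : ℂ) • y = x := ⟨(w i : ℂ)⁻¹ • x, smul_inv_smul₀ hwi x⟩
    rw [lpDiag_single, map_smul, weightedShift_single hq hC hw, ← neg_sub]
    exact Submodule.neg_mem _ (Submodule.subset_span ⟨(i, y), rfl⟩)

/-- The distance from `(x, 0, 0, …)` to the relations is at least `‖x‖ / 2 ^ ((p - 1) / p)`. -/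
theorem norm_le_norm_single_sub {p : ℝ} (hp : 1 ≤ p) (hqp : q.toReal = p) (hw : ∀ i, 0 < w i)
    (hw0 : w 0 = 1) (hstar : SatisfiesStar p w T) (x : X) {z : lp (fun _ : ℕ => X) q}
    (hz : z ∈ orbitRelations T w q) :
    ‖x‖ ≤ (2 : ℝ) ^ ((p - 1) / p) * ‖lp.single q 0 x - z‖ := by
  obtain ⟨k, hk, hk0, hstar⟩ := hstar
  obtain ⟨N, hN⟩ := orbitRelations_sum_eq_zero hw hz
  have hp0 : 0 < p := by linarith
  set u : lp (fun _ : ℕ => X) q := lp.single q 0 x - z with hu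
  let v : ℕ → X := fun j => (w j : ℂ)⁻¹ • u j
  have hwv : ∀ j, w j * ‖v j‖ = ‖u j‖ := fun j => by
    simp only [v]
    rw [norm_smul, norm_inv, Complex.norm_real, Real.norm_of_nonneg (hw j).le,
      mul_inv_cancel_left₀ (hw j).ne']
  -- `N ≤ k N`, so the relation `z` may be evaluated at the end of a block
  have h1 : ∑ j ∈ Finset.range (k N + 1), (T ^ (k N - j)) (v j) = (T ^ k N) x := by
    simp only [v, hu, lp.coeFn_sub, Pi.sub_apply, smul_sub, map_sub, Finset.sum_sub_distrib]
    rw [hN (k N) (hk.id_le N), sub_zero, Finset.sum_eq_single_of_mem 0 (by simp)]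
    · simp [hw0]
    · intro j _ hj
      rw [lp.single_apply, Pi.single_eq_of_ne hj, smul_zero, map_zero]
  have hsplit : Finset.range (k N + 1) = insert 0 (Finset.Ioc 0 (k N)) := by
    ext j
    simp only [Finset.mem_range, Finset.mem_insert, Finset.mem_Ioc]
    omega
  rw [hsplit, Finset.sum_insert (by simp), Nat.sub_zero] at h1
  have h2 := norm_le_of_pow_eq_sum hp (fun j _ => hw j) hk hk0 hstar (x - v 0) v N
    (by rw [map_sub, ← h1, add_sub_cancel_left])
  simp only [hwv] at h2
  have hv0 : ‖v 0‖ = ‖u 0‖ := by simpa [hw0] using hwv 0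
  have h3 : ‖x‖ ≤ ‖u 0‖ + ‖x - v 0‖ := by
    rw [← hv0]
    simpa using norm_add_le (v 0) (x - v 0)
  have hS : 0 ≤ ∑ j ∈ Finset.Ioc 0 (k N), ‖u j‖ ^ p :=
    Finset.sum_nonneg fun j _ => by positivity
  refine h3.trans ((add_le_add_right h2 _).trans ?_)
  refine (add_le_two_rpow_mul hp (norm_nonneg _) (Real.rpow_nonneg hS _)).trans ?_
  refine mul_le_mul_of_nonneg_left ?_ (by positivity)
  rw [Real.rpow_inv_rpow hS hp0.ne', Real.rpow_inv_le_iff_of_pos (by positivity) (norm_nonneg _) hp0]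
  have h4 := lp.sum_rpow_le_norm_rpow (hqp.symm ▸ hp0) u (Finset.range (k N + 1))
  rwa [hsplit, Finset.sum_insert (by simp), hqp] at h4

end Orbits

/-! ### The extension -/

theorem Submodule.le_norm_mk_topologicalClosure {Z : Type*} [NormedAddCommGroup Z]
    [NormedSpace ℂ Z] (N : Submodule ℂ Z) {x : Z} {r : ℝ} (h : ∀ z ∈ N, r ≤ ‖x - z‖) :
    r ≤ ‖(Submodule.Quotient.mk x : Z ⧸ N.topologicalClosure)‖ := by
  have h1 : ∀ z ∈ N.topologicalClosure, r ≤ ‖x - z‖ := fun z hz =>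
    closure_minimal (t := {z | r ≤ ‖x - z‖}) h
      (isClosed_le continuous_const (by fun_prop)) hz
  refine le_of_forall_pos_le_add fun ε hε => ?_
  obtain ⟨m, hm, hm'⟩ := Submodule.Quotient.norm_mk_lt
    (Submodule.Quotient.mk x : Z ⧸ N.topologicalClosure) hε
  have h2 := h1 (x - m) ((Submodule.Quotient.eq _).1 hm.symm)
  rw [sub_sub_cancel] at h2
  exact h2.trans hm'.le

theorem theorem3p5 (p : ℝ) (hp : 1 ≤ p)
    (X : Type u) [NormedAddCommGroup X] [NormedSpace ℂ X] [CompleteSpace X]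
    (T : X →L[ℂ] X) (c : ℕ → ℝ)
    (hpos : ∀ j, 1 ≤ j → 0 < c j)
    (hsub : ∀ i j, 1 ≤ i → 1 ≤ j → c (i + j) ≤ c i * c j)
    (hstar : SatisfiesStar p c T) :
    ∃ (Y : Type u) (_ : NormedAddCommGroup Y) (_ : NormedSpace ℂ Y) (_ : CompleteSpace Y)
      (π : X →L[ℂ] Y) (S : (Y →L[ℂ] Y)ˣ),
      IsSQpSpace p hp X Y ∧
      (∀ x : X, ‖x‖ / (2 : ℝ) ^ ((p - 1) / p) ≤ ‖π x‖ ∧ ‖π x‖ ≤ ‖x‖) ∧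
      (S : Y →L[ℂ] Y) ∘L π = π ∘L T ∧
      (∀ j : ℕ, 1 ≤ j → ‖((S⁻¹ : (Y →L[ℂ] Y)ˣ) : Y →L[ℂ] Y) ^ j‖ ≤ c j) ∧
      (∀ j : ℕ, 1 ≤ j → ‖(S : Y →L[ℂ] Y) ^ j‖ ≤ ‖T ^ j‖) ∧
      IsNearModulo c p π ((S⁻¹ : (Y →L[ℂ] Y)ˣ) : Y →L[ℂ] Y) 0 ∧
      spectrum ℂ (S : Y →L[ℂ] Y) ⊆ spectrum ℂ T := by
  have hp0 : 0 < p := by linarith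
  have : Fact (1 ≤ ENNReal.ofReal p) := fact_one_le_ofReal hp
  set q : ℝ≥0∞ := ENNReal.ofReal p with hqdef
  have hq : q ≠ ∞ := ENNReal.ofReal_ne_top
  have hqp : q.toReal = p := ENNReal.toReal_ofReal hp0.le
  -- the value `c 0` plays no role; the weight `1` at `0` makes `w` submultiplicative on all of `ℕ`
  let w : ℕ → ℝ := fun i => if i = 0 then 1 else c i
  have hw0 : w 0 = 1 := if_pos rfl
  have hwc : ∀ i, 1 ≤ i → w i = c i := fun i hi => if_neg (by omega)
  have hw : ∀ i, 0 < w i := fun i => by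
    rcases Nat.eq_zero_or_pos i with rfl | hi
    · rw [hw0]; exact one_pos
    · rw [hwc i hi]; exact hpos i hi
  have hwsub : ∀ i j, w (i + j) ≤ w j * w i := fun i j => by
    rcases Nat.eq_zero_or_pos i with rfl | hi
    · simp [hw0]
    rcases Nat.eq_zero_or_pos j with rfl | hj
    · simp [hw0]
    rw [hwc _ hi, hwc _ hj, hwc _ (by omega), mul_comm]
    exact hsub i j hi hj
  have hwstar : SatisfiesStar p w T := by
    obtain ⟨k, hk, hk0, h⟩ := hstar
    refine ⟨k, hk, hk0, fun n j h1 h2 => ?_⟩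
    rw [hwc j (by omega)]
    exact h n j h1 h2
  have hC : ∀ i, |w (i + 1) / w i| ≤ w 1 := fun i => by
    rw [abs_of_pos (div_pos (hw _) (hw _)), div_le_iff₀ (hw i)]
    exact hwsub i 1
  let N : Submodule ℂ (lp (fun _ : ℕ => X) q) := (orbitRelations T w q).topologicalClosure
  have hN : IsClosed (N : Set (lp (fun _ : ℕ => X) q)) := Submodule.isClosed_topologicalClosure _
  have hD : ∀ {R : X →L[ℂ] X}, R * T = T * R → ∀ z ∈ N, lpDiag hq R z ∈ N := fun hR =>
    Submodule.map_topologicalClosure_mem (lpDiag_mem_orbitRelations hq hR)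
  have hV : ∀ z ∈ N, weightedShift w hq (w 1) hC z ∈ N :=
    Submodule.map_topologicalClosure_mem (weightedShift_mem_orbitRelations hq hC hw)
  have hVT : ∀ z, weightedShift w hq (w 1) hC (lpDiag hq T z) - z ∈ N :=
    weightedShift_lpDiag_sub_mem hq hC hw
  let Y := lp (fun _ : ℕ => X) q ⧸ N
  let V := weightedShift (X := X) w hq (w 1) hC
  let S : (Y →L[ℂ] Y)ˣ :=
    { val := quotientOperator (lpDiag hq T) (hD rfl)
      inv := quotientOperator V hV
      val_inv := by
        ext y
        obtain ⟨z, rfl⟩ := Submodule.Quotient.mk_surjective _ y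
        rw [mul_apply_eq_comp, quotientOperator_mk, quotientOperator_mk, one_apply_eq_self,
          Submodule.Quotient.eq, ← weightedShift_lpDiag_comm]
        exact hVT z
      inv_val := by
        ext y
        obtain ⟨z, rfl⟩ := Submodule.Quotient.mk_surjective _ y
        rw [mul_apply_eq_comp, quotientOperator_mk, quotientOperator_mk, one_apply_eq_self,
          Submodule.Quotient.eq]
        exact hVT z }
  let π : X →L[ℂ] Y :=
    N.mkQL ∘L lp.singleContinuousLinearMap ℂ (fun _ : ℕ => X) q 0
  have hπ : ∀ x, π x = Submodule.Quotient.mk (lp.single q 0 x) := fun _ => rfl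
  have hS : ∀ z, (S : Y →L[ℂ] Y) (Submodule.Quotient.mk z)
      = Submodule.Quotient.mk (lpDiag hq T z) := fun _ => rfl
  have hSj : ∀ (j : ℕ) z, ((S : Y →L[ℂ] Y) ^ j)
      (Submodule.Quotient.mk z) = Submodule.Quotient.mk (lpDiag hq (T ^ j) z) := fun j => by
    induction j with
    | zero => intro z; rw [pow_zero, pow_zero, lpDiag_one]; rfl
    | succ j ih =>
      intro z
      rw [pow_succ', mul_apply_eq_comp, ih, hS, lpDiag_mul_apply, pow_succ']
  have hVj : ∀ (j : ℕ) z, (((S⁻¹ : (Y →L[ℂ] Y)ˣ) : Y →L[ℂ] Y) ^ j)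
      (Submodule.Quotient.mk z) = Submodule.Quotient.mk ((V ^ j) z) :=
    quotientOperator_pow_mk V hV
  refine ⟨Y, inferInstance, inferInstance, inferInstance, π, S,
    isSQpSpace_quotient_lp hp X N, fun x => ⟨?_, ?_⟩, ?_, fun j hj => ?_, fun j _ => ?_, ?_, ?_⟩
  · refine Submodule.le_norm_mk_topologicalClosure _ fun z hz => ?_
    rw [div_le_iff₀' (by positivity)]
    exact norm_le_norm_single_sub hp hqp hw hw0 hwstar x hz
  · rw [hπ]
    exact (Submodule.Quotient.norm_mk_le _ _).trans
      (lp.norm_single (zero_lt_one.trans_le Fact.out) _ _).le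
  · ext x
    simp only [ContinuousLinearMap.comp_apply, hπ, hS, lpDiag_single]
  · rw [← hwc j hj]
    exact Submodule.norm_clm_quotient_le (hVj j) (hw j).le
      (norm_weightedShift_pow_apply_le hq hC hw hwsub j)
  · exact Submodule.norm_clm_quotient_le (hSj j) (norm_nonneg _) (norm_lpDiag_apply_le hq _)
  · intro n x
    have h1 : ∀ j ∈ Finset.Icc 1 n,
        (((S⁻¹ : (Y →L[ℂ] Y)ˣ) : Y →L[ℂ] Y) ^ j - 0 ^ j) (π (x j))
          = N.mkQ (lp.single q j ((w j : ℂ) • x j)) := fun j hj => by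
      have hj1 : j ≠ 0 := by have := (Finset.mem_Icc.1 hj).1; omega
      rw [zero_pow hj1, sub_zero, hπ, hVj, ← weightedShift_pow_single_zero hq hC hw, hw0,
        Complex.ofReal_one, one_smul]
      rfl
    rw [Finset.sum_congr rfl h1, ← map_sum]
    refine (Submodule.Quotient.norm_mk_le _ _).trans ?_
    have h2 := lp.norm_sum_single (hqp.symm ▸ hp0) (fun j => (w j : ℂ) • x j) (Finset.Icc 1 n)
    rw [hqp] at h2
    rw [one_div, Real.le_rpow_inv_iff_of_pos (norm_nonneg _)
      (Finset.sum_nonneg fun j hj => mul_nonneg (Real.rpow_nonneg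
        (hpos j (Finset.mem_Icc.1 hj).1).le _) (Real.rpow_nonneg (norm_nonneg _) _)) hp0, h2]
    refine (Finset.sum_congr rfl fun j hj => ?_).le
    have hj1 := (Finset.mem_Icc.1 hj).1
    rw [norm_smul, Complex.norm_real, Real.norm_of_nonneg (hw j).le,
      Real.mul_rpow (hw j).le (norm_nonneg _), hwc j hj1]
  · intro a ha
    by_contra haT
    refine ha ?_
    obtain ⟨U, hU⟩ := spectrum.notMem_iff.1 haT
    -- the resolvent of `T` commutes with `T`, hence acts on the quotient
    have hUT : (U : X →L[ℂ] X) * T = T * U := by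
      rw [hU, sub_mul, mul_sub, Algebra.commutes]
    have hR : ((U⁻¹ : (X →L[ℂ] X)ˣ) : X →L[ℂ] X) * T = T * (U⁻¹ : (X →L[ℂ] X)ˣ) :=
      ((show Commute (U : X →L[ℂ] X) T from hUT).units_inv_left).eq
    have hval : ∀ z : lp (fun _ : ℕ => X) q,
        (algebraMap ℂ (Y →L[ℂ] Y) a - S) (Submodule.Quotient.mk z)
          = Submodule.Quotient.mk (lpDiag hq (U : X →L[ℂ] X) z) := fun z => by
      have hz : lpDiag hq (U : X →L[ℂ] X) z = a • z - lpDiag hq T z := by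
        ext i
        rw [lpDiag_apply, hU, lp.coeFn_sub, Pi.sub_apply, lp.coeFn_smul, Pi.smul_apply,
          lpDiag_apply]
        rfl
      rw [hz]
      rfl
    refine isUnit_iff_exists.2 ⟨quotientOperator _ (hD hR), ?_, ?_⟩
    · ext y
      obtain ⟨z, rfl⟩ := Submodule.Quotient.mk_surjective _ y
      rw [mul_apply_eq_comp, quotientOperator_mk, hval, lpDiag_mul_apply, U.mul_inv, lpDiag_one]
      rfl
    · ext y
      obtain ⟨z, rfl⟩ := Submodule.Quotient.mk_surjective _ y
      rw [mul_apply_eq_comp, hval, quotientOperator_mk, lpDiag_mul_apply, U.inv_mul, lpDiag_one]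
      rfl
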